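/- Let $\Delta,g\ge 3$ be integers. Then there exists a finite, non-empty, simple $\Delta$-regular graph $G$ of girth at least $g$ that has a frozen $(\Delta+1)$-colouring, that is, a proper vertex colouring with $\Delta+1$ colours in which every colour appears in the closed neighbourhood $N[v]=N(v)\cup\{v\}$ of every vertex $v$. Moreover, $G$ can be taken to be a $k$-lift of the complete graph $K_{\Delta+1}$ for some integer $k\ge 1$. Here a $k$-lift of a graph $H$ is a graph with vertex set $V(H)\times\{1,\dots,k\}$ whose edge set is obtained by placing, for every edge $uv$ of $H$, a perfect matching between $\{u\}\times\{1,\dots,k\}$ and $\{v\}\times\{1,\dots,k\}$. -/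

import Mathlib

/-- `G` is a `k`-lift of `H`: its vertex set is `V(H) × [k]`; over every edge `uv` of `H` there is a
perfect matching between `{u} × [k]` and `{v} × [k]` (the graph of a bijection `[k] → [k]`), and
`G` has no other edges. -/
structure IsLift {V : Type*} {k : ℕ} (H : SimpleGraph V) (G : SimpleGraph (V × Fin k)) : Prop where
  adj_of_adj : ∀ x y : V × Fin k, G.Adj x y → H.Adj x.1 y.1
  perfectMatching : ∀ u v : V, H.Adj u v →
    ∃ σ : Equiv.Perm (Fin k), ∀ i j : Fin k, G.Adj (u, i) (v, j) ↔ j = σ i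

/-- A proper colouring is frozen if every colour appears in the closed neighbourhood of every
vertex. -/
def IsFrozen {V C : Type*} {G : SimpleGraph V} (α : G.Coloring C) : Prop :=
  ∀ (v : V) (c : C), ∃ w : V, (w = v ∨ G.Adj v w) ∧ α w = c

/-! Give each edge `e` of the complete graph an involution `σ e`, used as the matching over `e` in
both directions. A cycle in the lift then projects to a word of edges with no two consecutive
letters equal, and this word fixes a point of the fibre. So it suffices that short nonempty reduced
words have no fixed points. Toggling first letters of bounded-length words gives involutions whose
short reduced products move the empty word; letting the permutation group act on itself by left
multiplication makes nontrivial products fixed-point-free. The projection to the base is the frozen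
colouring. -/

/-- Words over `E` of length at most `N` in which consecutive letters differ. -/
abbrev ReducedWord (E : Type*) (N : ℕ) : Type _ :=
  {l : List E // l.IsChain (· ≠ ·) ∧ l.length ≤ N}

namespace ReducedWord

variable {E : Type*} {N : ℕ}

instance [Finite E] : Finite (ReducedWord E N) :=
  ((List.finite_length_le E N).subset fun _ h => h.2).to_subtype

/-- The empty word. -/
def empty : ReducedWord E N := ⟨[], by simp⟩

open Classical in
/-- Delete the first letter if it is `e`; otherwise put `e` in front if there is room for it. -/
noncomputable def toggle (e : E) (w : ReducedWord E N) : ReducedWord E N :=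
  if w.1.head? = some e then ⟨w.1.tail, w.2.1.tail, by simpa using w.2.2.trans (Nat.le_succ N)⟩
  else if h : (e :: w.1).IsChain (· ≠ ·) ∧ (e :: w.1).length ≤ N then ⟨e :: w.1, h⟩
  else w

lemma toggle_cons_self {e : E} {w : List E}
    (hw : (e :: w).IsChain (· ≠ ·) ∧ (e :: w).length ≤ N) :
    (toggle e (⟨e :: w, hw⟩ : ReducedWord E N)).1 = w := by
  unfold toggle
  rw [if_pos (by simp)]
  rfl

lemma head?_ne_of_isChain_cons {e : E} {w : List E} (h : (e :: w).IsChain (· ≠ ·)) :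
    w.head? ≠ some e := by
  rcases w with _ | ⟨b, w⟩
  · simp
  · simpa [eq_comm] using (List.isChain_cons_cons.1 h).1

lemma toggle_of_isChain {e : E} {w : ReducedWord E N}
    (h : (e :: w.1).IsChain (· ≠ ·) ∧ (e :: w.1).length ≤ N) :
    toggle e w = ⟨e :: w.1, h⟩ := by
  unfold toggle
  rw [if_neg (head?_ne_of_isChain_cons h.1), dif_pos h]

lemma toggle_eq_self {e : E} {w : ReducedWord E N} (hw : w.1.head? ≠ some e)
    (h : ¬((e :: w.1).IsChain (· ≠ ·) ∧ (e :: w.1).length ≤ N)) : toggle e w = w := by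
  unfold toggle
  rw [if_neg hw, dif_neg h]

lemma toggle_involutive (e : E) : Function.Involutive (toggle (N := N) e) := by
  intro w
  by_cases hw : w.1.head? = some e
  · obtain ⟨_ | ⟨a, w⟩, hc⟩ := w
    · simp at hw
    obtain rfl : a = e := by simpa using hw
    have hv : toggle a (⟨a :: w, hc⟩ : ReducedWord E N) =
        ⟨w, hc.1.tail, (Nat.le_succ _).trans hc.2⟩ := Subtype.ext (toggle_cons_self hc)
    rw [hv]
    exact toggle_of_isChain hc
  · by_cases h : (e :: w.1).IsChain (· ≠ ·) ∧ (e :: w.1).length ≤ N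
    · rw [toggle_of_isChain h]
      exact Subtype.ext (toggle_cons_self h)
    · rw [toggle_eq_self hw h, toggle_eq_self hw h]

/-- `toggle e` as a permutation. -/
noncomputable def togglePerm (e : E) : Equiv.Perm (ReducedWord E N) := (toggle_involutive e).toPerm

/-- Every intermediate word is a suffix of the final one, hence reduced and short enough, so each
toggle inserts its letter. -/
lemma foldl_togglePerm (L : List E) (w : ReducedWord E N)
    (h : (L.reverse ++ w.1).IsChain (· ≠ ·) ∧ (L.reverse ++ w.1).length ≤ N) :
    L.foldl (fun x e => togglePerm e x) w = ⟨L.reverse ++ w.1, h⟩ := by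
  induction L generalizing w with
  | nil => rfl
  | cons e L ih =>
    have h' : (L.reverse ++ (e :: w.1)).IsChain (· ≠ ·) ∧
        (L.reverse ++ (e :: w.1)).length ≤ N := by simpa using h
    have he : (e :: w.1).IsChain (· ≠ ·) ∧ (e :: w.1).length ≤ N :=
      ⟨h'.1.right_of_append, by have := h'.2; simp at this ⊢; omega⟩
    have key : togglePerm e w = ⟨e :: w.1, he⟩ := toggle_of_isChain he
    rw [List.foldl_cons, key, ih ⟨e :: w.1, he⟩ h']
    exact Subtype.ext (by simp)

end ReducedWord

/-- A finite type `E` indexes involutive permutations of a finite set such that applying a nonempty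
reduced word of length at most `N` never fixes a point. -/
lemma exists_involutive_perms_foldl_ne (E : Type*) [Finite E] (N : ℕ) :
    ∃ (k : ℕ) (_ : 1 ≤ k) (σ : E → Equiv.Perm (Fin k)), (∀ e, Function.Involutive (σ e)) ∧
      ∀ L : List E, L ≠ [] → L.IsChain (· ≠ ·) → L.length ≤ N →
        ∀ i, L.foldl (fun x e => σ e x) i ≠ i := by
  -- The fibre is the whole permutation group, on which left multiplication is free.
  obtain ⟨k, ⟨f⟩⟩ := Finite.exists_equiv_fin (Equiv.Perm (ReducedWord E N))
  let τ : E → Equiv.Perm (ReducedWord E N) := ReducedWord.togglePerm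
  have hτ (e : E) : τ e * τ e = 1 := Equiv.ext (ReducedWord.toggle_involutive e)
  refine ⟨k, (f 1).pos, fun e => f.permCongr (Equiv.mulLeft (τ e)), fun e i => ?_,
    fun L hL hc hlen i hi => ?_⟩
  · simp [← mul_assoc, hτ]
  · have h₁ (L : List E) (i : Fin k) :
        f.symm (L.foldl (fun x e => f.permCongr (Equiv.mulLeft (τ e)) x) i) =
          L.foldl (fun x e => τ e * x) (f.symm i) := by
      induction L generalizing i with
      | nil => rfl
      | cons e L ih => rw [List.foldl_cons, ih]; simp
    have h₂ (L : List E) (x : Equiv.Perm (ReducedWord E N)) (w : ReducedWord E N) :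
        L.foldl (fun x e => τ e * x) x w = L.foldl (fun x e => τ e x) (x w) := by
      induction L generalizing x with
      | nil => rfl
      | cons e L ih => rw [List.foldl_cons, ih]; rfl
    have hr : (L.reverse ++ ([] : List E)).IsChain (· ≠ ·) := by
      simpa [List.isChain_reverse, ne_comm, Function.swap, flip] using hc
    have h₃ := ReducedWord.foldl_togglePerm (N := N) L ReducedWord.empty
      ⟨hr, by simpa [ReducedWord.empty] using hlen⟩
    -- Evaluate at the preimage of the empty word under `f.symm i`: a fixed point `i` would force
    -- `L.reverse` to be empty.
    have h₄ := h₂ L (f.symm i) ((f.symm i).symm ReducedWord.empty)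
    rw [← h₁, hi, Equiv.apply_symm_apply] at h₄
    have h₅ := congrArg Subtype.val (h₄.trans h₃)
    simp [ReducedWord.empty] at h₅
    exact hL h₅

namespace SimpleGraph

/-- A finite graph with all degrees at least two has a cycle. -/
lemma not_isAcyclic_of_two_le_degree {V : Type*} [Fintype V] [Nonempty V] {G : SimpleGraph V}
    [DecidableRel G.Adj] (h : ∀ v, 2 ≤ G.degree v) : ¬ G.IsAcyclic := by
  intro hG
  have ⟨u, v, p, hp, hmax⟩ := Walk.exists_isPath_forall_isPath_length_le_length G
  -- In a forest, a neighbour of `u` other than `p.snd` lies off the path and would extend it,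
  -- against maximality.
  have hsub : G.neighborFinset u ⊆ {p.snd} := by
    intro w hw
    have hadj : G.Adj u w := by simpa using hw
    rw [Finset.mem_singleton]
    refine hG.eq_snd_of_adj_start hp hadj ?_
    by_contra hn
    have := hmax _ _ _ (hp.cons (h := hadj.symm) hn)
    simp at this
  have := Finset.card_le_card hsub
  rw [card_neighborFinset_eq_degree, Finset.card_singleton] at this
  have := h u
  omega

/-- The lift of the complete graph on `V` whose matching over the edge `e` is the graph of the
involution `σ e`. -/
def involutiveLift {V : Type*} {k : ℕ} (σ : Sym2 V → Equiv.Perm (Fin k))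
    (hσ : ∀ e, Function.Involutive (σ e)) : SimpleGraph (V × Fin k) where
  Adj x y := x.1 ≠ y.1 ∧ y.2 = σ s(x.1, y.1) x.2
  symm := ⟨fun x y h => ⟨h.1.symm, by rw [h.2, Sym2.eq_swap, hσ]⟩⟩
  loopless := ⟨fun _ h => h.1 rfl⟩

section involutiveLift

variable {V : Type*} {k : ℕ} {σ : Sym2 V → Equiv.Perm (Fin k)}
  {hσ : ∀ e, Function.Involutive (σ e)}

lemma isLift_involutiveLift : IsLift (completeGraph V) (involutiveLift σ hσ) where
  adj_of_adj _ _ h := h.1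
  perfectMatching u v h := ⟨σ s(u, v), fun _ _ => ⟨fun h => h.2, fun h' => ⟨h, h'⟩⟩⟩

lemma foldl_edges_involutiveLift {x y : V × Fin k} (p : (involutiveLift σ hσ).Walk x y) :
    (p.edges.map (Sym2.map Prod.fst)).foldl (fun i e => σ e i) x.2 = y.2 := by
  induction p with
  | nil => rfl
  | cons h p ih => simp [← ih, h.2]

/-- Two consecutive steps over the same base edge apply one involution twice, so the walk retraces
an edge, which a trail cannot do. -/
lemma isChain_edges_involutiveLift {x y : V × Fin k} {p : (involutiveLift σ hσ).Walk x y}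
    (hp : p.IsTrail) : (p.edges.map (Sym2.map Prod.fst)).IsChain (· ≠ ·) := by
  induction p with
  | nil => simp
  | @cons u v _ h p ih =>
    rw [Walk.isTrail_cons] at hp
    cases p with
    | nil => simp
    | @cons _ w _ h' q =>
      have ih := ih hp.1
      simp only [Walk.edges_cons, List.map_cons, List.isChain_cons_cons] at ih ⊢
      refine ⟨fun heq => hp.2 ?_, ih⟩
      have huw : u.1 = w.1 := by
        simpa [Sym2.eq_swap (a := u.1), h.1] using heq
      have : u = w := by
        refine Prod.ext huw ?_
        rw [h'.2, h.2, ← huw, Sym2.eq_swap (a := v.1), hσ]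
      simp [this, Sym2.eq_swap]

lemma lt_length_of_isCycle_involutiveLift {N : ℕ}
    (h : ∀ L : List (Sym2 V), L ≠ [] → L.IsChain (· ≠ ·) → L.length ≤ N →
      ∀ i, L.foldl (fun x e => σ e x) i ≠ i)
    {x : V × Fin k} {p : (involutiveLift σ hσ).Walk x x} (hp : p.IsCycle) : N < p.length := by
  by_contra! hlen
  refine h (p.edges.map (Sym2.map Prod.fst)) ?_ (isChain_edges_involutiveLift hp.isTrail)
    (by simpa using hlen) x.2 (foldl_edges_involutiveLift p)
  intro hnil
  have hlen := congrArg List.length hnil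
  have := hp.three_le_length
  rw [List.length_map, Walk.length_edges, List.length_nil] at hlen
  omega

end involutiveLift

end SimpleGraph

section IsLift

variable {V : Type*} {k : ℕ} {H : SimpleGraph V} {G : SimpleGraph (V × Fin k)}

lemma IsLift.isRegularOfDegree [Fintype V] [DecidableRel H.Adj] [DecidableRel G.Adj] {d : ℕ}
    (h : IsLift H G) (hH : H.IsRegularOfDegree d) : G.IsRegularOfDegree d := by
  rintro ⟨u, i⟩
  rw [← hH u, ← SimpleGraph.card_neighborFinset_eq_degree,
    ← SimpleGraph.card_neighborFinset_eq_degree]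
  refine Finset.card_bij (fun y _ => y.1) ?_ ?_ ?_
  · intro y hy
    simpa using h.adj_of_adj _ _ (by simpa using hy)
  · rintro ⟨v, a⟩ ha ⟨w, b⟩ hb (rfl : v = w)
    rw [SimpleGraph.mem_neighborFinset] at ha hb
    obtain ⟨τ, hτ⟩ := h.perfectMatching u v (h.adj_of_adj _ _ ha)
    rw [(hτ i a).1 ha, (hτ i b).1 hb]
  · intro v hv
    obtain ⟨τ, hτ⟩ := h.perfectMatching u v (by simpa using hv)
    exact ⟨(v, τ i), by simpa using (hτ i _).2 rfl, rfl⟩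

/-- The projection of a lift of a complete graph is a frozen colouring. -/
lemma IsLift.exists_isFrozen (h : IsLift (SimpleGraph.completeGraph V) G) :
    ∃ α : G.Coloring V, IsFrozen α := by
  refine ⟨SimpleGraph.Coloring.mk Prod.fst fun hxy => h.adj_of_adj _ _ hxy, fun x c => ?_⟩
  by_cases hc : x.1 = c
  · exact ⟨x, Or.inl rfl, hc⟩
  · obtain ⟨τ, hτ⟩ := h.perfectMatching x.1 c hc
    exact ⟨(c, τ x.2), Or.inr ((hτ _ _).2 rfl), rfl⟩

end IsLift

theorem mainTheorem5 (Δ g : ℕ) (hΔ : 3 ≤ Δ) (hg : 3 ≤ g) :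
    ∃ (k : ℕ) (_ : 1 ≤ k) (G : SimpleGraph (Fin (Δ + 1) × Fin k)) (_ : DecidableRel G.Adj),
      IsLift (SimpleGraph.completeGraph (Fin (Δ + 1))) G ∧
      G.IsRegularOfDegree Δ ∧
      g ≤ G.girth ∧
      ∃ α : G.Coloring (Fin (Δ + 1)), IsFrozen α := by
  classical
  obtain ⟨k, hk, σ, hσ, h⟩ := exists_involutive_perms_foldl_ne (Sym2 (Fin (Δ + 1))) g
  have hlift := SimpleGraph.isLift_involutiveLift (hσ := hσ)
  have hreg : (SimpleGraph.involutiveLift σ hσ).IsRegularOfDegree Δ :=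
    hlift.isRegularOfDegree fun v => by
      convert SimpleGraph.complete_graph_degree v
      simp
  refine ⟨k, hk, SimpleGraph.involutiveLift σ hσ, inferInstance, hlift, hreg, ?_,
    hlift.exists_isFrozen⟩
  have : NeZero k := ⟨by omega⟩
  -- A cycle must exist, since `girth` is `0` on acyclic graphs.
  have hcyc := SimpleGraph.not_isAcyclic_of_two_le_degree fun v =>
    (show 2 ≤ Δ by omega).trans_eq (hreg v).symm
  obtain ⟨_, p, hp, hlen⟩ := SimpleGraph.exists_girth_eq_length.2 hcyc
  rw [hlen]
  exact (SimpleGraph.lt_length_of_isCycle_involutiveLift h hp).le
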